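/- Let $\mathcal K_1,\mathcal K_2$ be complex Hilbert spaces, $\mathcal H=\mathcal K_1\oplus\mathcal K_2$, and let $A_j$ be a bounded self-adjoint operator on $\mathcal K_j$ $(j=1,2)$. Let $\varphi=(\varphi_1,\varphi_2)\in\mathcal H$ be such that $\varphi_j$ is a cyclic vector for $A_j$ (the vectors $A_j^n\varphi_j$, $n\ge 0$, span a dense subspace of $\mathcal K_j$), and let $\lambda\in\mathbb R\setminus\{0\}$. Put $$B=A_1\oplus A_2,\qquad C=B+\lambda\langle\varphi,\cdot\,\rangle\varphi .$$ For a bounded self-adjoint operator $T$ and a vector $u$ let $\mu^T_u$ be the spectral measure of $u$ for $T$, i.e. the Borel measure on $\mathbb R$ with $\int f\,d\mu^T_u=\langle u,f(T)u\rangle$ for all $f\in C_c(\mathbb R)$, and for a measure $\mu$ let $\mu_{\mathrm s}$ be its singular part with respect to Lebesgue measure. Say that $S$ and $T$ have mutually singular singular parts if $(\mu^S_u)_{\mathrm s}\perp(\mu^T_v)_{\mathrm s}$ for all vectors $u,v$. Write $\mu_j=\mu^{A_j}_{\varphi_j}$. Then: 1. $B$ and $C$ have mutually singular singular parts if and only if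 $A_1$ and $A_2$ have mutually singular singular parts. 2. There are pairwise disjoint Borel sets $X,Y,Z$ with $X\cup Y\cup Z=\mathbb R$ such that $\mu_1\restriction X$ and $\mu_2\restriction X$ are mutually absolutely continuous and $\mu_1(Y)=\mu_2(Z)=0$. For every such choice of $X,Y,Z$, the singular parts of $B$ and $C$ overlap exactly in $\chi_X(\mu_1+\mu_2)_{\mathrm s}$; that is, for every Borel measure $\nu$ on $\mathbb R$, $$\nu\ll\chi_X(\mu_1+\mu_2)_{\mathrm s}\iff \nu\ll(\mu^B_u)_{\mathrm s}\ \text{and}\ \nu\ll(\mu^C_v)_{\mathrm s}\ \text{ for some } u,v\in\mathcal H .$$ -/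

import Mathlib

open MeasureTheory CompactlySupported

namespace KacGilbert

section SpectralMeasures

/-- The functional `f ↦ Re ⟪φ, f(A) φ⟫` on compactly supported real continuous functions, where
`f(A)` is the continuous functional calculus of a bounded self-adjoint operator `A`. -/
noncomputable def spectralFunctional {H : Type*} [NormedAddCommGroup H] [InnerProductSpace ℂ H]
    [CompleteSpace H] (A : H →L[ℂ] H) (φ : H) : C_c(ℝ, ℝ) →ₚ[ℝ] ℝ :=
  PositiveLinearMap.mk₀
    { toFun := fun f => (inner ℂ φ (cfc (fun x : ℝ => f x) A φ)).re
      map_add' := by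
        intro f g
        have h : cfc (fun x : ℝ => (f + g) x) A
            = cfc (fun x : ℝ => f x) A + cfc (fun x : ℝ => g x) A :=
          cfc_add A (fun x => f x) (fun x => g x) f.continuous.continuousOn
            g.continuous.continuousOn
        rw [h, add_apply, inner_add_right, Complex.add_re]
      map_smul' := by
        intro c f
        have h : cfc (fun x : ℝ => (c • f) x) A = c • cfc (fun x : ℝ => f x) A :=
          cfc_smul c (fun x => f x) A f.continuous.continuousOn
        rw [h, smul_apply, inner_smul_right_eq_smul, Complex.smul_re,
          RingHom.id_apply] }
    (by
      intro f hf
      have h : 0 ≤ cfc (fun x : ℝ => f x) A := cfc_nonneg fun x _ => hf x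
      exact ((ContinuousLinearMap.nonneg_iff_isPositive _).1 h).re_inner_nonneg_right φ)

/-- The spectral measure of the vector `φ` for the bounded self-adjoint operator `A`: the regular
Borel measure `μ` on `ℝ` with `∫ f dμ = ⟪φ, f(A) φ⟫` for all `f ∈ C_c(ℝ)`. -/
noncomputable def spectralMeasure {H : Type*} [NormedAddCommGroup H] [InnerProductSpace ℂ H]
    [CompleteSpace H] (A : H →L[ℂ] H) (φ : H) : Measure ℝ :=
  RealRMK.rieszMeasure (spectralFunctional A φ)

/-- The part of a measure on `ℝ` that is singular with respect to Lebesgue measure. -/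
noncomputable def singPart (μ : Measure ℝ) : Measure ℝ :=
  μ.singularPart volume

/-- `φ` is a cyclic vector for the self-adjoint operator `A`: the vectors `Aⁿ φ` span a dense
subspace. -/
def IsCyclicVector {H : Type*} [NormedAddCommGroup H] [InnerProductSpace ℂ H]
    (A : H →L[ℂ] H) (φ : H) : Prop :=
  (Submodule.span ℂ (Set.range fun n : ℕ => (A ^ n) φ)).topologicalClosure = ⊤

end SpectralMeasures

section SingularParts

variable {H : Type*} [NormedAddCommGroup H] [InnerProductSpace ℂ H] [CompleteSpace H]
  {H' : Type*} [NormedAddCommGroup H'] [InnerProductSpace ℂ H'] [CompleteSpace H']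

/-- Two bounded self-adjoint operators have mutually singular singular parts: the singular part of
every spectral measure of the one and that of every spectral measure of the other are mutually
singular. -/
def MutuallySingularSingularParts (S : H →L[ℂ] H) (T : H' →L[ℂ] H') : Prop :=
  ∀ (u : H) (v : H'), singPart (spectralMeasure S u) ⟂ₘ singPart (spectralMeasure T v)

/-- The measure `ν` is dominated by the singular part of the self-adjoint operator `T`, that is,
`ν` is absolutely continuous with respect to the singular part of some spectral measure of `T`.
On a separable space this says `ν ≪ (μ_max)_s`, with `μ_max` of maximal spectral type. -/
def DominatedBySingularPart (T : H →L[ℂ] H) (ν : Measure ℝ) : Prop :=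
  ∃ u : H, ν ≪ singPart (spectralMeasure T u)

/-- The singular parts of `S` and `T` overlap exactly in (the measure class of) `κ`: the measures
dominated by the singular parts of both operators are exactly the measures `ν ≪ κ`. In other words
the class of `κ` is the greatest lower bound of the singular spectral types of `S` and `T`. -/
def SingularPartsOverlapExactlyIn (S : H →L[ℂ] H) (T : H' →L[ℂ] H') (κ : Measure ℝ) : Prop :=
  ∀ ν : Measure ℝ, (DominatedBySingularPart S ν ∧ DominatedBySingularPart T ν) ↔ ν ≪ κ

end SingularParts

section Operators

/-- The direct sum `A₁ ⊕ A₂` on the Hilbert space direct sum `K₁ ⊕ K₂`. -/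
noncomputable def directSum {K₁ K₂ : Type*} [NormedAddCommGroup K₁] [InnerProductSpace ℂ K₁]
    [NormedAddCommGroup K₂] [InnerProductSpace ℂ K₂]
    (A₁ : K₁ →L[ℂ] K₁) (A₂ : K₂ →L[ℂ] K₂) : WithLp 2 (K₁ × K₂) →L[ℂ] WithLp 2 (K₁ × K₂) :=
  (WithLp.prodContinuousLinearEquiv 2 ℂ K₁ K₂).symm.toContinuousLinearMap ∘L
    A₁.prodMap A₂ ∘L (WithLp.prodContinuousLinearEquiv 2 ℂ K₁ K₂).toContinuousLinearMap

/-- The rank one perturbation `B + r ⟪φ, ·⟫ φ`. -/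
noncomputable def rankOnePerturbation {H : Type*} [NormedAddCommGroup H] [InnerProductSpace ℂ H]
    (B : H →L[ℂ] H) (r : ℝ) (φ : H) : H →L[ℂ] H :=
  B + (r : ℂ) • (innerSL ℂ φ).smulRight φ

end Operators

/-- Pairwise disjoint Borel sets `X`, `Y`, `Z` with union `ℝ` such that `μ₁` and `μ₂` are equivalent
on `X`, `μ₁ Y = 0` and `μ₂ Z = 0`. -/
structure IsComparisonPartition (μ₁ μ₂ : Measure ℝ) (X Y Z : Set ℝ) : Prop where
  measurableSet_X : MeasurableSet X
  measurableSet_Y : MeasurableSet Y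
  measurableSet_Z : MeasurableSet Z
  disjoint_XY : Disjoint X Y
  disjoint_XZ : Disjoint X Z
  disjoint_YZ : Disjoint Y Z
  union_eq : X ∪ Y ∪ Z = Set.univ
  ac₁₂ : μ₁.restrict X ≪ μ₂.restrict X
  ac₂₁ : μ₂.restrict X ≪ μ₁.restrict X
  null_Y : μ₁ Y = 0
  null_Z : μ₂ Z = 0

end KacGilbert

namespace KacGilbert

/-! Let `K` be the cyclic subspace of `φ` for `B`. It reduces `B`, and the rank one term acts only
inside `K`, so `B` and `C` coincide on the orthogonal complement of `K`. Inside `K` the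
Aronszajn–Donoghue theorem (`mutuallySingular_rankOnePerturbation`) makes the singular parts for `B`
and `C` disjoint. Hence any overlap comes from the complement.

Let `w` be the component of `(φ₁, 0)` orthogonal to `K`, with spectral measure `ω`. Since `(φ₁, 0)`
and `(0, φ₂)` sum to `φ`, their orthogonal components are `w` and `-w`, so `ω ≤ μ₁` and `ω ≤ μ₂`;
thus `ω` lives on `X`. Conversely, if `ω` vanishes on `s`, then on `s` the vector `(φ₁, 0)` is a
limit of vectors `(p(A₁)φ₁, p(A₂)φ₂)`: the same `p` is near `1` for `μ₁` and near `0` for `μ₂`,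
which forces `μ₁` and `μ₂` to be mutually singular on `s`
(`mutuallySingular_restrict_of_orthogonalPart`). Therefore `ω` is equivalent to `μ₁ + μ₂` restricted
to `X`.

By cyclicity, `φ` and `w` together control every spectral measure of `C`
(`spectralMeasure_rankOnePerturbation_ac`), so the overlap is exactly the singular part of `ω`. The
first claim is the case of zero overlap. -/

theorem aeval_intertwine {H H' : Type*} [NormedAddCommGroup H] [InnerProductSpace ℂ H]
    [NormedAddCommGroup H'] [InnerProductSpace ℂ H'] {S : H →L[ℂ] H} {T : H' →L[ℂ] H'} (V : H →L[ℂ] H')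
    (h : V ∘L S = T ∘L V) (p : Polynomial ℂ) :
    V ∘L Polynomial.aeval S p = Polynomial.aeval T p ∘L V := by
  induction p using Polynomial.induction_on' with
  | add p q hp hq => rw [map_add, map_add, ContinuousLinearMap.comp_add, hp, hq,
      ContinuousLinearMap.add_comp]
  | monomial n a =>
    have hn : V ∘L (S ^ n) = (T ^ n) ∘L V := by
      induction n with
      | zero => ext; simp
      | succ n ih =>
        rw [pow_succ, pow_succ]
        calc V ∘L (S ^ n * S) = (V ∘L S ^ n) ∘L S := rfl
          _ = (T ^ n) ∘L (V ∘L S) := by rw [ih]; rfl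
          _ = (T ^ n * T) ∘L V := by rw [h]; rfl
    rw [Polynomial.aeval_monomial, Polynomial.aeval_monomial, Algebra.algebraMap_eq_smul_one,
      Algebra.algebraMap_eq_smul_one, smul_one_mul, smul_one_mul, ContinuousLinearMap.comp_smul,
      ContinuousLinearMap.smul_comp, hn]

/-! ### Spectral measures and the functional calculus. -/

section SpectralMeasureBasics

variable {H : Type*} [NormedAddCommGroup H] [InnerProductSpace ℂ H] [CompleteSpace H]
  {H' : Type*} [NormedAddCommGroup H'] [InnerProductSpace ℂ H'] [CompleteSpace H']

theorem spectralFunctional_apply (A : H →L[ℂ] H) (u : H) (f : C_c(ℝ, ℝ)) :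
    spectralFunctional A u f = (inner ℂ u (cfc (fun x : ℝ => f x) A u)).re := rfl

theorem integral_spectralMeasure (A : H →L[ℂ] H) (u : H) (f : C_c(ℝ, ℝ)) :
    ∫ x, f x ∂(spectralMeasure A u) = (inner ℂ u (cfc (fun x : ℝ => f x) A u)).re := by
  rw [spectralMeasure, RealRMK.integral_rieszMeasure, spectralFunctional_apply]

instance (A : H →L[ℂ] H) (u : H) : (spectralMeasure A u).Regular :=
  RealRMK.regular_rieszMeasure _

/-- By inner regularity it suffices to test cutoff functions with values in `[0, 1]`, whose
functional calculus has norm at most `1`. -/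
theorem spectralMeasure_univ_le (A : H →L[ℂ] H) (u : H) :
    spectralMeasure A u Set.univ ≤ ENNReal.ofReal (‖u‖ ^ 2) := by
  rw [isOpen_univ.measure_eq_iSup_isCompact]
  refine iSup_le fun K => iSup_le fun _ => iSup_le fun hK => ?_
  obtain ⟨f, hf1, -, hfc, hf01⟩ :=
    exists_continuous_one_zero_of_isCompact hK isClosed_empty (Set.disjoint_empty K)
  let g : C_c(ℝ, ℝ) := ⟨f, hfc⟩
  refine (RealRMK.rieszMeasure_le_of_eq_one (spectralFunctional A u) (f := g)
    (fun x => (hf01 x).1) hK hf1).trans (ENNReal.ofReal_le_ofReal ?_)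
  rw [spectralFunctional_apply]
  have hn : ‖cfc (fun x : ℝ => g x) A‖ ≤ 1 :=
    norm_cfc_le zero_le_one fun x _ => by
      rw [Real.norm_eq_abs, abs_le]
      exact ⟨neg_one_lt_zero.le.trans (hf01 x).1, (hf01 x).2⟩
  calc _ ≤ ‖inner ℂ u (cfc (fun x : ℝ => g x) A u)‖ := Complex.re_le_norm _
    _ ≤ ‖u‖ * ‖cfc (fun x : ℝ => g x) A u‖ := norm_inner_le_norm _ _
    _ ≤ ‖u‖ * (1 * ‖u‖) := by
        gcongr
        exact ContinuousLinearMap.le_of_opNorm_le _ hn u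
    _ = ‖u‖ ^ 2 := by ring

theorem spectralMeasure_le (A : H →L[ℂ] H) (u : H) (s : Set ℝ) :
    spectralMeasure A u s ≤ ENNReal.ofReal (‖u‖ ^ 2) :=
  (measure_mono (Set.subset_univ s)).trans (spectralMeasure_univ_le A u)

instance (A : H →L[ℂ] H) (u : H) : IsFiniteMeasure (spectralMeasure A u) :=
  ⟨(spectralMeasure_univ_le A u).trans_lt ENNReal.ofReal_lt_top⟩

theorem integrable_compactlySupported (m : Measure ℝ) [IsLocallyFiniteMeasure m]
    (f : C_c(ℝ, ℝ)) : Integrable (fun x => f x) m :=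
  f.continuous.integrable_of_hasCompactSupport f.hasCompactSupport

theorem eq_spectralMeasure (A : H →L[ℂ] H) (u : H) (m : Measure ℝ) [m.Regular]
    (h : ∀ f : C_c(ℝ, ℝ), ∫ x, f x ∂m = (inner ℂ u (cfc (fun x : ℝ => f x) A u)).re) :
    m = spectralMeasure A u :=
  Measure.ext_of_integral_eq_on_compactlySupported fun f => by
    rw [h f, integral_spectralMeasure]

/-- Each `u ↦ ⟪u, f(A) u⟫` is a quadratic form. The identity yields subadditivity up to a factor `2`
without introducing complex cross measures. -/
theorem spectralMeasure_parallelogram (A : H →L[ℂ] H) (u v : H) :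
    spectralMeasure A (u + v) + spectralMeasure A (u - v) =
      (spectralMeasure A u + spectralMeasure A u) +
        (spectralMeasure A v + spectralMeasure A v) := by
  refine Measure.ext_of_integral_eq_on_compactlySupported fun f => ?_
  have hi : ∀ w : H, Integrable (fun x => f x) (spectralMeasure A w) := fun w =>
    integrable_compactlySupported _ f
  rw [integral_add_measure (hi _) (hi _), integral_add_measure ((hi _).add_measure (hi _))
    ((hi _).add_measure (hi _)), integral_add_measure (hi _) (hi _),
    integral_add_measure (hi _) (hi _)]
  simp only [integral_spectralMeasure, map_add, map_sub, inner_add_left, inner_add_right,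
    inner_sub_left, inner_sub_right, Complex.add_re, Complex.sub_re]
  ring

theorem spectralMeasure_add_le (A : H →L[ℂ] H) (u v : H) (s : Set ℝ) :
    spectralMeasure A (u + v) s ≤ 2 * spectralMeasure A u s + 2 * spectralMeasure A v s := by
  have h := congrArg (fun m : Measure ℝ => m s) (spectralMeasure_parallelogram A u v)
  simp only [Measure.add_apply] at h
  rw [two_mul, two_mul, ← h]
  exact le_self_add

theorem spectralMeasure_add_of_orthogonal (A : H →L[ℂ] H) (u v : H)
    (h : ∀ f : C_c(ℝ, ℝ), inner ℂ u (cfc (fun x : ℝ => f x) A v) = 0 ∧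
      inner ℂ v (cfc (fun x : ℝ => f x) A u) = 0) :
    spectralMeasure A (u + v) = spectralMeasure A u + spectralMeasure A v := by
  refine (eq_spectralMeasure A _ _ fun f => ?_).symm
  rw [integral_add_measure (integrable_compactlySupported _ f)
    (integrable_compactlySupported _ f)]
  simp only [integral_spectralMeasure, map_add, inner_add_left, inner_add_right, Complex.add_re,
    h f]
  simp

theorem spectralMeasure_neg (A : H →L[ℂ] H) (u : H) :
    spectralMeasure A (-u) = spectralMeasure A u :=
  eq_spectralMeasure A _ _ (fun f => by simp [integral_spectralMeasure]) |>.symm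

/-- The functional calculus is compatible with intertwining operators. -/
theorem cfc_intertwine {S : H →L[ℂ] H} {T : H' →L[ℂ] H'} (hS : IsSelfAdjoint S)
    (hT : IsSelfAdjoint T) (V : H →L[ℂ] H') (h : V ∘L S = T ∘L V) {f : ℝ → ℝ}
    (hf : Continuous f) : V ∘L cfc f S = cfc f T ∘L V := by
  have hp : ∀ p : Polynomial ℝ, V ∘L Polynomial.aeval S p = Polynomial.aeval T p ∘L V := fun p => by
    rw [← Polynomial.aeval_map_algebraMap ℂ S p, ← Polynomial.aeval_map_algebraMap ℂ T p]
    exact aeval_intertwine V h _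
  -- Weierstrass approximation on an interval containing both spectra reduces the claim to
  -- polynomials.
  have key : ∀ ε : ℝ, 0 < ε → ‖V ∘L cfc f S - cfc f T ∘L V‖ ≤ 2 * ‖V‖ * ε := by
    intro ε hε
    obtain ⟨R, hR⟩ := (((spectrum.isCompact (𝕜 := ℝ) S).union
      (spectrum.isCompact (𝕜 := ℝ) T)).isBounded).subset_closedBall 0
    rw [Real.closedBall_eq_Icc] at hR
    obtain ⟨p, hpf⟩ := exists_polynomial_near_of_continuousOn (0 - R) (0 + R) f hf.continuousOn ε hε
    have hS' : ‖cfc f S - Polynomial.aeval S p‖ ≤ ε := by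
      rw [← cfc_polynomial p S, ← cfc_sub ..]
      refine norm_cfc_le hε.le fun x hx => ?_
      rw [Real.norm_eq_abs, abs_sub_comm]
      exact (hpf x (hR (Or.inl hx))).le
    have hT' : ‖cfc f T - Polynomial.aeval T p‖ ≤ ε := by
      rw [← cfc_polynomial p T, ← cfc_sub ..]
      refine norm_cfc_le hε.le fun x hx => ?_
      rw [Real.norm_eq_abs, abs_sub_comm]
      exact (hpf x (hR (Or.inr hx))).le
    have : V ∘L cfc f S - cfc f T ∘L V = V ∘L (cfc f S - Polynomial.aeval S p) -
        (cfc f T - Polynomial.aeval T p) ∘L V := by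
      rw [ContinuousLinearMap.comp_sub, ContinuousLinearMap.sub_comp, hp]
      abel
    rw [this]
    calc _ ≤ ‖V ∘L (cfc f S - Polynomial.aeval S p)‖ +
        ‖(cfc f T - Polynomial.aeval T p) ∘L V‖ := norm_sub_le _ _
      _ ≤ ‖V‖ * ε + ε * ‖V‖ := by
        gcongr
        · exact (ContinuousLinearMap.opNorm_comp_le _ _).trans (by gcongr)
        · exact (ContinuousLinearMap.opNorm_comp_le _ _).trans (by gcongr)
      _ = _ := by ring
  rw [← sub_eq_zero, ← norm_le_zero_iff]
  refine le_of_forall_pos_le_add fun δ hδ => ?_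
  -- The `+ 1` keeps the denominator positive when `V = 0`.
  refine (key (δ / (2 * ‖V‖ + 1)) (by positivity)).trans ?_
  rw [zero_add, mul_div_assoc', div_le_iff₀ (by positivity)]
  nlinarith [norm_nonneg V]

theorem spectralMeasure_intertwine {S : H →L[ℂ] H} {T : H' →L[ℂ] H'} (hS : IsSelfAdjoint S)
    (hT : IsSelfAdjoint T) (V : H →L[ℂ] H') (h : V ∘L S = T ∘L V)
    (hV : ∀ x y, inner ℂ (V x) (V y) = inner ℂ x y) (u : H) :
    spectralMeasure T (V u) = spectralMeasure S u := by
  refine (eq_spectralMeasure T _ _ fun f => ?_).symm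
  rw [integral_spectralMeasure, ← hV]
  exact congrArg (fun y => (inner ℂ (V u) y).re)
    (DFunLike.congr_fun (cfc_intertwine hS hT V h f.continuous) u)

theorem star_aeval_mul_cfc_mul_aeval {A : H →L[ℂ] H} (hA : IsSelfAdjoint A) (p : Polynomial ℂ)
    {f : ℝ → ℝ} (hf : Continuous f) :
    star (Polynomial.aeval A p) * cfc f A * Polynomial.aeval A p =
      cfc (fun x : ℝ => ‖p.eval (x : ℂ)‖ ^ 2 * f x) A := by
  have hN := hA.isStarNormal
  rw [cfc_real_eq_complex f, cfc_real_eq_complex _, ← cfc_polynomial p A, ← cfc_star,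
    ← cfc_mul .., ← cfc_mul ..]
  refine cfc_congr fun x hx => ?_
  have hx' : x = (x.re : ℂ) := hA.mem_spectrum_eq_re hx
  rw [← hx', mul_right_comm, Complex.star_def, Complex.conj_mul']
  push_cast
  rfl

/-- Moving `p(A)` to the other side of the inner product gives `p(A)* f(A) p(A) = (|p|² f)(A)`. -/
theorem spectralMeasure_aeval {A : H →L[ℂ] H} (hA : IsSelfAdjoint A) (p : Polynomial ℂ) (u : H) :
    spectralMeasure A (Polynomial.aeval A p u) =
      (spectralMeasure A u).withDensity fun x => ENNReal.ofReal (‖p.eval (x : ℂ)‖ ^ 2) := by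
  have hc : Continuous fun x : ℝ => ‖p.eval (x : ℂ)‖ ^ 2 := by fun_prop
  have := IsLocallyFiniteMeasure.withDensity_ofReal (μ := spectralMeasure A u) hc
  refine (eq_spectralMeasure A _ _ fun f => ?_).symm
  rw [integral_withDensity_eq_integral_toReal_smul (by fun_prop)
    (Filter.Eventually.of_forall fun _ => ENNReal.ofReal_lt_top)]
  have hcs : HasCompactSupport fun x : ℝ => ‖p.eval (x : ℂ)‖ ^ 2 * f x :=
    HasCompactSupport.mul_left (f := fun x : ℝ => ‖p.eval (x : ℂ)‖ ^ 2) f.hasCompactSupport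
  let g : C_c(ℝ, ℝ) := ⟨⟨fun x => ‖p.eval (x : ℂ)‖ ^ 2 * f x, hc.mul f.continuous⟩, hcs⟩
  have hg := integral_spectralMeasure A u g
  have e : ∀ x, g x = (ENNReal.ofReal (‖p.eval (x : ℂ)‖ ^ 2)).toReal • f x := fun x => by
    rw [ENNReal.toReal_ofReal (by positivity)]; rfl
  simp only [← e]
  rw [hg]
  change (inner ℂ u (cfc (fun x : ℝ => ‖p.eval (x : ℂ)‖ ^ 2 * f x) A u)).re = _
  rw [← star_aeval_mul_cfc_mul_aeval (f := fun x => f x) hA p f.continuous]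
  simp only [mul_apply_eq_comp, ContinuousLinearMap.star_eq_adjoint,
    ContinuousLinearMap.adjoint_inner_right]

end SpectralMeasureBasics

/-! ### Cyclic subspaces. -/

section CyclicSubspace

variable {H : Type*} [NormedAddCommGroup H] [InnerProductSpace ℂ H]

theorem rankOnePerturbation_apply (B : H →L[ℂ] H) (r : ℝ) (φ x : H) :
    rankOnePerturbation B r φ x = B x + (r : ℂ) • inner ℂ φ x • φ := by
  simp [rankOnePerturbation]

/-- The closed subspace generated by the vectors `Aⁿ u`. -/
def cyclicSubspace (A : H →L[ℂ] H) (u : H) : Submodule ℂ H :=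
  (Submodule.span ℂ (Set.range fun n : ℕ => (A ^ n) u)).topologicalClosure

theorem mem_cyclicSubspace_self (A : H →L[ℂ] H) (u : H) : u ∈ cyclicSubspace A u :=
  Submodule.le_topologicalClosure _ (Submodule.subset_span ⟨0, by simp⟩)

theorem cyclicSubspace_le {A : H →L[ℂ] H} {u : H} {K : Submodule ℂ H}
    (hK : IsClosed (K : Set H)) (hA : ∀ v ∈ K, A v ∈ K) (hu : u ∈ K) : cyclicSubspace A u ≤ K := by
  refine Submodule.topologicalClosure_minimal _ (Submodule.span_le.2 ?_) hK
  rintro _ ⟨n, rfl⟩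
  change (A ^ n) u ∈ K
  induction n with
  | zero => simpa using hu
  | succ n ih => rw [pow_succ', mul_apply_eq_comp]; exact hA _ ih

theorem exists_aeval_eq_of_mem_span {A : H →L[ℂ] H} {u v : H}
    (hv : v ∈ Submodule.span ℂ (Set.range fun n : ℕ => (A ^ n) u)) :
    ∃ p : Polynomial ℂ, Polynomial.aeval A p u = v := by
  induction hv using Submodule.span_induction with
  | mem x hx => obtain ⟨n, rfl⟩ := hx; exact ⟨Polynomial.X ^ n, by simp⟩
  | zero => exact ⟨0, by simp⟩
  | add x y _ _ hx hy =>
    obtain ⟨p, rfl⟩ := hx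
    obtain ⟨q, rfl⟩ := hy
    exact ⟨p + q, by simp⟩
  | smul a x _ hx =>
    obtain ⟨p, rfl⟩ := hx
    exact ⟨a • p, by simp⟩

theorem map_mem_cyclicSubspace {A : H →L[ℂ] H} {u v : H} (hv : v ∈ cyclicSubspace A u) :
    A v ∈ cyclicSubspace A u := by
  refine (Submodule.span ℂ (Set.range fun n : ℕ => (A ^ n) u)).topologicalClosure_minimal
    (t := (cyclicSubspace A u).comap (A : H →ₗ[ℂ] H)) (Submodule.span_le.2 ?_) ?_ hv
  · rintro _ ⟨n, rfl⟩
    refine Submodule.le_topologicalClosure _ (Submodule.subset_span ⟨n + 1, ?_⟩)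
    change (A ^ (n + 1)) u = A ((A ^ n) u)
    rw [pow_succ', mul_apply_eq_comp]
  · exact (Submodule.isClosed_topologicalClosure _).preimage A.continuous

end CyclicSubspace

/-! ### Absolute continuity through closed invariant subspaces of null vectors. -/

section Domination

open Filter Topology

variable {H : Type*} [NormedAddCommGroup H] [InnerProductSpace ℂ H] [CompleteSpace H]

theorem spectralMeasure_aeval_ac {A : H →L[ℂ] H} (hA : IsSelfAdjoint A) (p : Polynomial ℂ)
    (u : H) : spectralMeasure A (Polynomial.aeval A p u) ≪ spectralMeasure A u := by
  rw [spectralMeasure_aeval hA]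
  exact withDensity_absolutelyContinuous _ _

/-- The vectors whose spectral measure vanishes on a given set. -/
def nullSubmodule {A : H →L[ℂ] H} (hA : IsSelfAdjoint A) (s : Set ℝ) : Submodule ℂ H where
  carrier := {u | spectralMeasure A u s = 0}
  add_mem' := by
    intro u v hu hv
    have h := spectralMeasure_add_le A u v s
    rw [Set.mem_ofPred_eq] at hu hv
    rw [hu, hv, mul_zero, add_zero] at h
    exact nonpos_iff_eq_zero.1 h
  zero_mem' := by
    have h := spectralMeasure_le A 0 s
    simpa using h
  smul_mem' := by
    intro c u hu
    have h := spectralMeasure_aeval_ac hA (Polynomial.C c) u hu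
    rwa [Polynomial.aeval_C, Algebra.algebraMap_eq_smul_one, smul_apply,
      one_apply_eq_self] at h

theorem mem_nullSubmodule {A : H →L[ℂ] H} (hA : IsSelfAdjoint A) {s : Set ℝ} {u : H} :
    u ∈ nullSubmodule hA s ↔ spectralMeasure A u s = 0 := Iff.rfl

/-- If `v n → u` with every `v n` null on `s`, the mass of `u` on `s` is at most `2‖u - v n‖²`. -/
theorem isClosed_nullSubmodule {A : H →L[ℂ] H} (hA : IsSelfAdjoint A) (s : Set ℝ) :
    IsClosed (nullSubmodule hA s : Set H) := by
  refine isClosed_of_closure_subset fun u hu => ?_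
  obtain ⟨v, hv, hvu⟩ := mem_closure_iff_seq_limit.1 hu
  have hb : ∀ n, spectralMeasure A u s ≤ 2 * ENNReal.ofReal (‖u - v n‖ ^ 2) := fun n => by
    have h := spectralMeasure_add_le A (v n) (u - v n) s
    rw [add_sub_cancel, (mem_nullSubmodule hA).1 (hv n), mul_zero, zero_add] at h
    exact h.trans (by gcongr; exact spectralMeasure_le A _ s)
  have hl : Tendsto (fun n => 2 * ENNReal.ofReal (‖u - v n‖ ^ 2)) atTop (𝓝 0) := by
    have h1 : Tendsto (fun n => ‖u - v n‖ ^ 2) atTop (𝓝 0) := by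
      simpa using ((tendsto_const_nhds (x := u)).sub hvu).norm.pow 2
    have h2 := ENNReal.Tendsto.const_mul (a := 2) (ENNReal.tendsto_ofReal h1) (Or.inr (by simp))
    simpa using h2
  exact nonpos_iff_eq_zero.1 (ge_of_tendsto' hl hb)

theorem aeval_mem_nullSubmodule {A : H →L[ℂ] H} (hA : IsSelfAdjoint A) {s : Set ℝ} {u : H}
    (hu : u ∈ nullSubmodule hA s) (p : Polynomial ℂ) :
    Polynomial.aeval A p u ∈ nullSubmodule hA s :=
  spectralMeasure_aeval_ac hA p u hu

theorem map_mem_nullSubmodule {A : H →L[ℂ] H} (hA : IsSelfAdjoint A) {s : Set ℝ} {u : H}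
    (hu : u ∈ nullSubmodule hA s) : A u ∈ nullSubmodule hA s := by
  simpa using aeval_mem_nullSubmodule hA hu Polynomial.X

theorem spectralMeasure_ac_of_mem_cyclicSubspace {A : H →L[ℂ] H} (hA : IsSelfAdjoint A) {u v : H}
    (hv : v ∈ cyclicSubspace A u) : spectralMeasure A v ≪ spectralMeasure A u := fun s hs =>
  cyclicSubspace_le (isClosed_nullSubmodule hA s) (fun _ h => map_mem_nullSubmodule hA h)
    ((mem_nullSubmodule hA).2 hs) hv

end Domination

/-! ### Resolvents and the Aronszajn–Donoghue theorem. -/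

section RankOne

open Filter Topology

variable {H : Type*} [NormedAddCommGroup H] [InnerProductSpace ℂ H] [CompleteSpace H]

theorem isUnit_algebraMap_sub {A : H →L[ℂ] H} (hA : IsSelfAdjoint A) {z : ℂ} (hz : z.im ≠ 0) :
    IsUnit (algebraMap ℂ (H →L[ℂ] H) z - A) := by
  by_contra h
  refine hz ?_
  have := hA.mem_spectrum_eq_re (spectrum.mem_iff.2 h)
  rw [this, Complex.ofReal_im]

theorem exists_resolvent_vector {A : H →L[ℂ] H} (hA : IsSelfAdjoint A) {z : ℂ} (hz : z.im ≠ 0)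
    (u : H) : ∃ ψ, z • ψ - A ψ = u := by
  obtain ⟨R, hR⟩ := (isUnit_algebraMap_sub hA hz).exists_right_inv
  refine ⟨R u, ?_⟩
  have := DFunLike.congr_fun hR u
  simpa [Algebra.algebraMap_eq_smul_one] using this

theorem resolvent_vector_unique {A : H →L[ℂ] H} (hA : IsSelfAdjoint A) {z : ℂ} (hz : z.im ≠ 0)
    {ψ ψ' : H} (h : z • ψ - A ψ = z • ψ' - A ψ') : ψ = ψ' := by
  obtain ⟨R, hR⟩ := (isUnit_algebraMap_sub hA hz).exists_left_inv
  have e : ∀ v, R (z • v - A v) = v := fun v => by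
    have := DFunLike.congr_fun hR v
    simpa [Algebra.algebraMap_eq_smul_one] using this
  rw [← e ψ, h, e]

/-- With `z = x + iε`, the measure of `u` is `|z - t|²` times that of `ψ`, and `|z - t|² ≤ 2ε²` on
the ball. Self-adjointness gives `|Im ⟪u, ψ⟫| = ε‖ψ‖²`. -/
theorem spectralMeasure_closedBall_le {A : H →L[ℂ] H} (hA : IsSelfAdjoint A) {x ε : ℝ}
    (hε : 0 < ε) {u ψ : H} (h : (⟨x, ε⟩ : ℂ) • ψ - A ψ = u) :
    spectralMeasure A u (Metric.closedBall x ε) ≤ ENNReal.ofReal (2 * ε * ‖inner ℂ u ψ‖) := by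
  have hu : Polynomial.aeval A (Polynomial.C (⟨x, ε⟩ : ℂ) - Polynomial.X) ψ = u := by
    rw [← h]
    simp [Algebra.algebraMap_eq_smul_one]
  have hb : spectralMeasure A u (Metric.closedBall x ε) ≤
      ENNReal.ofReal (2 * ε ^ 2) * ENNReal.ofReal (‖ψ‖ ^ 2) := by
    rw [← hu, spectralMeasure_aeval hA, withDensity_apply _ Metric.isClosed_closedBall.measurableSet]
    calc _ ≤ ∫⁻ _ in Metric.closedBall x ε, ENNReal.ofReal (2 * ε ^ 2) ∂(spectralMeasure A ψ) := by
          refine setLIntegral_mono measurable_const fun t ht => ENNReal.ofReal_le_ofReal ?_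
          rw [Metric.mem_closedBall, Real.dist_eq] at ht
          have h2 : (t - x) ^ 2 ≤ ε ^ 2 := sq_le_sq' (by linarith [abs_le.1 ht]) (abs_le.1 ht).2
          simp only [Polynomial.eval_sub, Polynomial.eval_C, Polynomial.eval_X, ← Complex.normSq_eq_norm_sq,
            Complex.normSq_apply, Complex.sub_re, Complex.sub_im, Complex.ofReal_re,
            Complex.ofReal_im]
          nlinarith
      _ ≤ _ := by
          rw [setLIntegral_const]
          gcongr
          exact spectralMeasure_le A _ _
  refine hb.trans ?_
  rw [← ENNReal.ofReal_mul (by positivity)]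
  refine ENNReal.ofReal_le_ofReal ?_
  have him : (inner ℂ u ψ).im = -(ε * ‖ψ‖ ^ 2) := by
    rw [← h, inner_sub_left, inner_smul_left, Complex.sub_im]
    have h0 : (inner ℂ (A ψ) ψ).im = 0 :=
      (ContinuousLinearMap.isSelfAdjoint_iff_isSymmetric.1 hA).im_inner_apply_self ψ
    rw [h0, inner_self_eq_norm_sq_to_K, Complex.mul_im]
    simp [← Complex.ofReal_pow]
  have hle := Complex.abs_im_le_norm (inner ℂ u ψ)
  rw [him, abs_neg, abs_of_nonneg (by positivity)] at hle
  nlinarith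

/-- The density of Lebesgue measure with respect to `μ` vanishes almost everywhere for the singular
part, so by Besicovitch differentiation the Lebesgue measure of small balls is negligible against
their `μ`-mass. -/
theorem ae_singPart_lt_closedBall (μ : Measure ℝ) [IsFiniteMeasure μ] :
    ∀ᵐ x ∂(singPart μ), ∀ M : ℝ, 0 < M →
      ∀ᶠ ε in 𝓝[>] (0 : ℝ), ENNReal.ofReal (M * ε) < μ (Metric.closedBall x ε) := by
  have hs : singPart μ ⟂ₘ volume := Measure.mutuallySingular_singularPart μ volume
  have hle : singPart μ ≤ μ := Measure.singularPart_le μ volume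
  have h0 : ∀ᵐ x ∂(singPart μ), volume.rnDeriv μ x = 0 := by
    have hz : ∫⁻ x in hs.nullSetᶜ, volume.rnDeriv μ x ∂μ = 0 := by
      refine nonpos_iff_eq_zero.1 ((Measure.setLIntegral_rnDeriv_le _).trans ?_)
      exact hs.measure_compl_nullSet.le
    rw [setLIntegral_eq_zero_iff hs.measurableSet_nullSet.compl (by fun_prop)] at hz
    have h1 : ∀ᵐ x ∂(singPart μ), x ∈ hs.nullSetᶜ := by
      rw [ae_iff]; simp
    filter_upwards [h1, (Measure.absolutelyContinuous_of_le hle).ae_le hz] with x hx hx'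
    exact hx' hx
  filter_upwards [h0, (Measure.absolutelyContinuous_of_le hle).ae_le
    (Besicovitch.ae_tendsto_rnDeriv volume μ)] with x hx hx' M hM
  rw [hx] at hx'
  have hc : (0 : ENNReal) < ENNReal.ofReal (2 / M) := ENNReal.ofReal_pos.2 (by positivity)
  filter_upwards [hx'.eventually_lt_const hc, self_mem_nhdsWithin] with ε hε hpos
  have hpos : 0 < ε := hpos
  have hv : volume (Metric.closedBall x ε) ≠ 0 := by
    simp [hpos]
  rw [ENNReal.div_lt_iff (Or.inr hv) (Or.inr measure_closedBall_lt_top.ne), Real.volume_closedBall] at hε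
  have h2 : ENNReal.ofReal (2 * ε) = ENNReal.ofReal (2 / M) * ENNReal.ofReal (M * ε) := by
    rw [← ENNReal.ofReal_mul (by positivity)]
    congr 1
    field_simp
  rw [h2] at hε
  exact lt_of_mul_lt_mul_left' hε

theorem isSelfAdjoint_rankOnePerturbation {B : H →L[ℂ] H} (hB : IsSelfAdjoint B) (r : ℝ) (φ : H) :
    IsSelfAdjoint (rankOnePerturbation B r φ) := by
  rw [ContinuousLinearMap.isSelfAdjoint_iff_isSymmetric] at *
  intro x y
  have h := hB x y
  simp only [ContinuousLinearMap.coe_coe] at h ⊢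
  simp only [rankOnePerturbation, add_apply, smul_apply, ContinuousLinearMap.smulRight_apply,
    innerSL_apply_apply, inner_add_left, inner_add_right, inner_smul_left, inner_smul_right, h,
    Complex.conj_ofReal, inner_conj_symm]
  ring

/-- **Aronszajn–Donoghue**: the singular parts of the spectral measures of `φ` for `B` and for its
rank one perturbation along `φ` are mutually singular. -/
theorem mutuallySingular_rankOnePerturbation {B : H →L[ℂ] H} (hB : IsSelfAdjoint B) {r : ℝ}
    (hr : r ≠ 0) (φ : H) :
    singPart (spectralMeasure B φ) ⟂ₘ
      singPart (spectralMeasure (rankOnePerturbation B r φ) φ) := by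
  have hC := isSelfAdjoint_rankOnePerturbation hB r φ
  refine Measure.MutuallySingular.mk
    (ae_iff.1 (ae_singPart_lt_closedBall (spectralMeasure B φ)))
    (ae_iff.1 (ae_singPart_lt_closedBall (spectralMeasure (rankOnePerturbation B r φ) φ)))
    fun x _ => ?_
  by_contra hx
  simp only [Set.mem_union, Set.mem_ofPred_eq, not_or, not_not] at hx
  -- This growth rate forces `|F|, |G| > 2/|r|`, hence `1/|F| + 1/|G| < |r|`, against the resolvent
  -- identity `1/F - 1/G = r`.
  have hM : 0 < 4 / |r| := by positivity
  obtain ⟨ε, ⟨h1, h2⟩, hε⟩ :=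
    (((hx.1 _ hM).and (hx.2 _ hM)).and self_mem_nhdsWithin).exists
  have hε : 0 < ε := hε
  have hz : (⟨x, ε⟩ : ℂ).im ≠ 0 := hε.ne'
  obtain ⟨ψ, hψ⟩ := exists_resolvent_vector hB hz φ
  obtain ⟨χ, hχ⟩ := exists_resolvent_vector hC hz φ
  have e1 := h1.trans_le (spectralMeasure_closedBall_le hB hε hψ)
  have e2 := h2.trans_le (spectralMeasure_closedBall_le hC hε hχ)
  rw [ENNReal.ofReal_lt_ofReal_iff_of_nonneg (by positivity)] at e1 e2
  set F := inner ℂ φ ψ with hF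
  set G := inner ℂ φ χ with hG
  -- Applying `z - C` to `ψ` gives `φ - r⟪φ, ψ⟫φ`, a multiple of `φ`.
  have hψχ : ψ = (1 - (r : ℂ) * F) • χ := by
    refine resolvent_vector_unique hC hz ?_
    rw [map_smul, smul_comm, ← smul_sub, hχ, rankOnePerturbation_apply, ← sub_sub, hψ, sub_smul,
      one_smul, smul_smul]
  have hFG : G - F = (r : ℂ) * F * G := by
    have : F = (1 - (r : ℂ) * F) * G := by
      rw [hG, ← inner_smul_right, ← hψχ]
    linear_combination -this
  have hn : |r| * ‖F‖ * ‖G‖ ≤ ‖F‖ + ‖G‖ := by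
    have := norm_sub_le G F
    rw [hFG, norm_mul, norm_mul, Complex.norm_real, Real.norm_eq_abs] at this
    linarith
  have hr' : 0 < |r| := abs_pos.2 hr
  have f1 : 2 < |r| * ‖F‖ := by
    have : 4 / |r| < 2 * ‖F‖ := by nlinarith
    rw [div_lt_iff₀ hr'] at this
    linarith
  have f2 : 2 < |r| * ‖G‖ := by
    have : 4 / |r| < 2 * ‖G‖ := by nlinarith
    rw [div_lt_iff₀ hr'] at this
    linarith
  have g1 : 0 < ‖F‖ := by by_contra hc; nlinarith [norm_nonneg F]
  have g2 : 0 < ‖G‖ := by by_contra hc; nlinarith [norm_nonneg G]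
  nlinarith

end RankOne

/-! ### The orthogonal complement of the cyclic subspace. -/

section ComplementaryPart

variable {H : Type*} [NormedAddCommGroup H] [InnerProductSpace ℂ H] [CompleteSpace H]

instance (A : H →L[ℂ] H) (u : H) : CompleteSpace (cyclicSubspace A u) :=
  (Submodule.isClosed_topologicalClosure _).completeSpace_coe

/-- The component of `a` orthogonal to the cyclic subspace of `A` generated by `u`. -/
noncomputable def orthogonalPart (A : H →L[ℂ] H) (u a : H) : H :=
  a - (cyclicSubspace A u).starProjection a

theorem commute_starProjection {A : H →L[ℂ] H} (hA : IsSelfAdjoint A) (u : H) :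
    Commute A (cyclicSubspace A u).starProjection := by
  set K := cyclicSubspace A u
  ext x
  rw [mul_apply_eq_comp, mul_apply_eq_comp]
  refine (Submodule.eq_starProjection_of_mem_of_inner_eq_zero
    (map_mem_cyclicSubspace (K.starProjection_apply_mem x)) fun w hw => ?_).symm
  rw [← map_sub]
  have h := (ContinuousLinearMap.isSelfAdjoint_iff_isSymmetric.1 hA) (x - K.starProjection x) w
  simp only [ContinuousLinearMap.coe_coe] at h
  rw [h]
  exact Submodule.starProjection_inner_eq_zero x _ (map_mem_cyclicSubspace hw)

theorem cfc_mem_cyclicSubspace {A : H →L[ℂ] H} (hA : IsSelfAdjoint A) {u v : H}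
    (hv : v ∈ cyclicSubspace A u) (f : ℝ → ℝ) : cfc f A v ∈ cyclicSubspace A u := by
  have h := DFunLike.congr_fun ((commute_starProjection hA u).cfc_real f) v
  rw [mul_apply_eq_comp, mul_apply_eq_comp, Submodule.starProjection_eq_self_iff.2 hv] at h
  rw [h]
  exact Submodule.starProjection_apply_mem _ _

theorem inner_cfc_symm (A : H →L[ℂ] H) (f : ℝ → ℝ) (x y : H) :
    inner ℂ (cfc f A x) y = inner ℂ x (cfc f A y) :=
  (ContinuousLinearMap.isSelfAdjoint_iff_isSymmetric.1 (cfc_predicate f A)) x y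

theorem spectralMeasure_add_orthogonalPart {A : H →L[ℂ] H} (hA : IsSelfAdjoint A) {u v : H} (a : H)
    (hv : v ∈ cyclicSubspace A u) :
    spectralMeasure A (v + orthogonalPart A u a) =
      spectralMeasure A v + spectralMeasure A (orthogonalPart A u a) := by
  have h : ∀ w ∈ cyclicSubspace A u, inner ℂ (orthogonalPart A u a) w = 0 := fun w hw =>
    Submodule.starProjection_inner_eq_zero a w hw
  refine spectralMeasure_add_of_orthogonal A _ _ fun f => ⟨?_, ?_⟩
  · rw [← inner_cfc_symm, inner_eq_zero_symm]
    exact h _ (cfc_mem_cyclicSubspace hA hv _)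
  · exact h _ (cfc_mem_cyclicSubspace hA hv _)

theorem spectralMeasure_orthogonalPart_le {A : H →L[ℂ] H} (hA : IsSelfAdjoint A) (u a : H) :
    spectralMeasure A (orthogonalPart A u a) ≤ spectralMeasure A a := by
  have h := spectralMeasure_add_orthogonalPart hA (u := u) a
    ((cyclicSubspace A u).starProjection_apply_mem a)
  rw [orthogonalPart, add_sub_cancel] at h
  rw [orthogonalPart, h]
  exact Measure.le_add_left le_rfl

/-- Used with `a = (φ₁, 0)` and `u - a = (0, φ₂)`, to bound a single measure by both `μ₁` and `μ₂`.
-/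
theorem orthogonalPart_sub (A : H →L[ℂ] H) (u a : H) :
    orthogonalPart A u (u - a) = -orthogonalPart A u a := by
  rw [orthogonalPart, orthogonalPart, map_sub,
    Submodule.starProjection_eq_self_iff.2 (mem_cyclicSubspace_self A u)]
  abel

/-- The projection `V` onto the complement kills the pairing with `φ`, so it intertwines `B` with
`B` and also `B` with the perturbation. -/
theorem spectralMeasure_rankOnePerturbation_orthogonalPart {B : H →L[ℂ] H} (hB : IsSelfAdjoint B)
    (r : ℝ) (φ a : H) :
    spectralMeasure (rankOnePerturbation B r φ) (orthogonalPart B φ a) =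
      spectralMeasure B (orthogonalPart B φ a) := by
  set V : H →L[ℂ] H := 1 - (cyclicSubspace B φ).starProjection with hV
  have hVa : ∀ x, V x = orthogonalPart B φ x := fun x => rfl
  have hBV : V ∘L B = B ∘L V :=
    (((Commute.one_right B).sub_right (commute_starProjection hB φ)).eq).symm
  have hCV : V ∘L B = rankOnePerturbation B r φ ∘L V := by
    rw [hBV]
    ext x
    have h0 : inner ℂ φ (V x) = 0 := by
      rw [inner_eq_zero_symm]
      exact Submodule.starProjection_inner_eq_zero x _ (mem_cyclicSubspace_self B φ)
    simp [rankOnePerturbation_apply, h0]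
  refine eq_spectralMeasure _ _ _ fun f => ?_
  rw [integral_spectralMeasure, ← hVa]
  have h1 := DFunLike.congr_fun (cfc_intertwine hB hB V hBV f.continuous) a
  have h2 := DFunLike.congr_fun (cfc_intertwine hB
    (isSelfAdjoint_rankOnePerturbation hB r φ) V hCV f.continuous) a
  exact congrArg (fun y => (inner ℂ (V a) y).re) (h2.symm.trans h1)

end ComplementaryPart

/-! ### Direct sums and the measure of the orthogonal part. -/

section DirectSum

variable {K₁ K₂ : Type*} [NormedAddCommGroup K₁] [InnerProductSpace ℂ K₁]
  [NormedAddCommGroup K₂] [InnerProductSpace ℂ K₂]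

/-- The inclusion of the first summand. -/
noncomputable def inlL2 (K₁ K₂ : Type*) [NormedAddCommGroup K₁] [InnerProductSpace ℂ K₁]
    [NormedAddCommGroup K₂] [InnerProductSpace ℂ K₂] : K₁ →L[ℂ] WithLp 2 (K₁ × K₂) :=
  (WithLp.prodContinuousLinearEquiv 2 ℂ K₁ K₂).symm.toContinuousLinearMap ∘L
    ContinuousLinearMap.inl ℂ K₁ K₂

/-- The inclusion of the second summand. -/
noncomputable def inrL2 (K₁ K₂ : Type*) [NormedAddCommGroup K₁] [InnerProductSpace ℂ K₁]
    [NormedAddCommGroup K₂] [InnerProductSpace ℂ K₂] : K₂ →L[ℂ] WithLp 2 (K₁ × K₂) :=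
  (WithLp.prodContinuousLinearEquiv 2 ℂ K₁ K₂).symm.toContinuousLinearMap ∘L
    ContinuousLinearMap.inr ℂ K₁ K₂

theorem inlL2_apply (x : K₁) : inlL2 K₁ K₂ x = WithLp.toLp 2 (x, 0) := rfl

theorem inrL2_apply (y : K₂) : inrL2 K₁ K₂ y = WithLp.toLp 2 (0, y) := rfl

theorem inlL2_add_inrL2 (u : WithLp 2 (K₁ × K₂)) :
    inlL2 K₁ K₂ u.fst + inrL2 K₁ K₂ u.snd = u := by
  rw [inlL2_apply, inrL2_apply, ← WithLp.toLp_add, Prod.mk_add_mk, add_zero, zero_add]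
  rfl

theorem inner_inlL2 (x y : K₁) : inner ℂ (inlL2 K₁ K₂ x) (inlL2 K₁ K₂ y) = inner ℂ x y := by
  simp [inlL2_apply, WithLp.prod_inner_apply]

theorem inner_inrL2 (x y : K₂) : inner ℂ (inrL2 K₁ K₂ x) (inrL2 K₁ K₂ y) = inner ℂ x y := by
  simp [inrL2_apply, WithLp.prod_inner_apply]

theorem inner_inlL2_inrL2 (x : K₁) (y : K₂) :
    inner ℂ (inlL2 K₁ K₂ x) (inrL2 K₁ K₂ y) = 0 := by
  simp [inlL2_apply, inrL2_apply, WithLp.prod_inner_apply]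

theorem directSum_comp_inlL2 (A₁ : K₁ →L[ℂ] K₁) (A₂ : K₂ →L[ℂ] K₂) :
    inlL2 K₁ K₂ ∘L A₁ = directSum A₁ A₂ ∘L inlL2 K₁ K₂ := by
  ext x
  simp [directSum, inlL2]

theorem directSum_comp_inrL2 (A₁ : K₁ →L[ℂ] K₁) (A₂ : K₂ →L[ℂ] K₂) :
    inrL2 K₁ K₂ ∘L A₂ = directSum A₁ A₂ ∘L inrL2 K₁ K₂ := by
  ext x
  simp [directSum, inrL2]

variable [CompleteSpace K₁] [CompleteSpace K₂] {A₁ : K₁ →L[ℂ] K₁} {A₂ : K₂ →L[ℂ] K₂}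

theorem isSelfAdjoint_directSum (hA₁ : IsSelfAdjoint A₁) (hA₂ : IsSelfAdjoint A₂) :
    IsSelfAdjoint (directSum A₁ A₂) := by
  rw [ContinuousLinearMap.isSelfAdjoint_iff_isSymmetric] at *
  intro x y
  have h1 := hA₁ x.fst y.fst
  have h2 := hA₂ x.snd y.snd
  simp only [ContinuousLinearMap.coe_coe] at h1 h2 ⊢
  simp [WithLp.prod_inner_apply, directSum] at h1 h2 ⊢
  rw [h1, h2]

theorem spectralMeasure_directSum (hA₁ : IsSelfAdjoint A₁) (hA₂ : IsSelfAdjoint A₂) (x : K₁)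
    (y : K₂) : spectralMeasure (directSum A₁ A₂) (inlL2 K₁ K₂ x + inrL2 K₁ K₂ y) =
      spectralMeasure A₁ x + spectralMeasure A₂ y := by
  have hB := isSelfAdjoint_directSum hA₁ hA₂
  rw [spectralMeasure_add_of_orthogonal,
    spectralMeasure_intertwine hA₁ hB _ (directSum_comp_inlL2 A₁ A₂) inner_inlL2,
    spectralMeasure_intertwine hA₂ hB _ (directSum_comp_inrL2 A₁ A₂) inner_inrL2]
  intro f
  have h1 := DFunLike.congr_fun (cfc_intertwine hA₁ hB _ (directSum_comp_inlL2 A₁ A₂)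
    f.continuous) x
  have h2 := DFunLike.congr_fun (cfc_intertwine hA₂ hB _ (directSum_comp_inrL2 A₁ A₂)
    f.continuous) y
  simp only [ContinuousLinearMap.comp_apply] at h1 h2
  exact ⟨h2 ▸ inner_inlL2_inrL2 _ _, h1 ▸ inner_eq_zero_symm.1 (inner_inlL2_inrL2 _ _)⟩

theorem spectralMeasure_directSum_inlL2 (hA₁ : IsSelfAdjoint A₁) (hA₂ : IsSelfAdjoint A₂)
    (x : K₁) : spectralMeasure (directSum A₁ A₂) (inlL2 K₁ K₂ x) = spectralMeasure A₁ x :=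
  spectralMeasure_intertwine hA₁ (isSelfAdjoint_directSum hA₁ hA₂) _
    (directSum_comp_inlL2 A₁ A₂) inner_inlL2 x

theorem spectralMeasure_directSum_inrL2 (hA₁ : IsSelfAdjoint A₁) (hA₂ : IsSelfAdjoint A₂)
    (y : K₂) : spectralMeasure (directSum A₁ A₂) (inrL2 K₁ K₂ y) = spectralMeasure A₂ y :=
  spectralMeasure_intertwine hA₂ (isSelfAdjoint_directSum hA₁ hA₂) _
    (directSum_comp_inrL2 A₁ A₂) inner_inrL2 y

theorem spectralMeasure_ac_of_isCyclicVector (hA₁ : IsSelfAdjoint A₁) {x : K₁}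
    (hx : IsCyclicVector A₁ x) (u : K₁) : spectralMeasure A₁ u ≪ spectralMeasure A₁ x :=
  spectralMeasure_ac_of_mem_cyclicSubspace hA₁ (by
    rw [cyclicSubspace, show Submodule.topologicalClosure _ = ⊤ from hx]; trivial)

/-- The vector `φ` and the part of `(φ₁, 0)` orthogonal to the cyclic subspace of `φ` together
generate the whole space under the perturbed operator. -/
theorem spectralMeasure_rankOnePerturbation_ac (hA₁ : IsSelfAdjoint A₁) (hA₂ : IsSelfAdjoint A₂)
    {φ : WithLp 2 (K₁ × K₂)} (hφ₁ : IsCyclicVector A₁ φ.fst) (hφ₂ : IsCyclicVector A₂ φ.snd)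
    (r : ℝ) (v : WithLp 2 (K₁ × K₂)) :
    spectralMeasure (rankOnePerturbation (directSum A₁ A₂) r φ) v ≪
      spectralMeasure (rankOnePerturbation (directSum A₁ A₂) r φ) φ +
        spectralMeasure (directSum A₁ A₂)
          (orthogonalPart (directSum A₁ A₂) φ (inlL2 K₁ K₂ φ.fst)) := by
  set B := directSum A₁ A₂ with hBdef
  have hB : IsSelfAdjoint B := isSelfAdjoint_directSum hA₁ hA₂
  have hC := isSelfAdjoint_rankOnePerturbation hB r φ
  set a := inlL2 K₁ K₂ φ.fst with ha
  intro s hs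
  rw [← spectralMeasure_rankOnePerturbation_orthogonalPart hB r, Measure.add_apply,
    add_eq_zero] at hs
  set N := nullSubmodule hC s with hN
  have hcl : IsClosed (N : Set (WithLp 2 (K₁ × K₂))) := isClosed_nullSubmodule hC s
  have hφ : φ ∈ N := hs.1
  have hw : orthogonalPart B φ a ∈ N := hs.2
  -- `B x` differs from the perturbed operator applied to `x` by a multiple of `φ`, which lies in
  -- `N`.
  have hBN : ∀ x ∈ N, B x ∈ N := fun x hx => by
    have h1 := map_mem_nullSubmodule hC hx
    rw [rankOnePerturbation_apply] at h1
    exact (N.add_mem_iff_left (N.smul_mem _ (N.smul_mem _ hφ))).1 h1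
  have haN : a ∈ N := by
    have h1 := cyclicSubspace_le hcl hBN hφ ((cyclicSubspace B φ).starProjection_apply_mem a)
    have h2 := N.add_mem hw h1
    rwa [orthogonalPart, sub_add_cancel] at h2
  have hbN : inrL2 K₁ K₂ φ.snd ∈ N := by
    have h1 := N.sub_mem hφ haN
    rwa [sub_eq_of_eq_add' (inlL2_add_inrL2 φ).symm] at h1
  have e1 : ∀ x, inlL2 K₁ K₂ x ∈ N := fun x => by
    have h1 : cyclicSubspace A₁ φ.fst ≤ N.comap (inlL2 K₁ K₂ : K₁ →ₗ[ℂ] _) :=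
      cyclicSubspace_le (hcl.preimage (inlL2 K₁ K₂).continuous) (fun y hy => by
        have h2 := DFunLike.congr_fun (directSum_comp_inlL2 A₁ A₂) y
        exact (congrArg (· ∈ N) h2).mpr (hBN _ hy)) haN
    refine h1 ?_
    rw [cyclicSubspace, show Submodule.topologicalClosure _ = ⊤ from hφ₁]; trivial
  have e2 : ∀ x, inrL2 K₁ K₂ x ∈ N := fun x => by
    have h1 : cyclicSubspace A₂ φ.snd ≤ N.comap (inrL2 K₁ K₂ : K₂ →ₗ[ℂ] _) :=
      cyclicSubspace_le (hcl.preimage (inrL2 K₁ K₂).continuous) (fun y hy => by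
        have h2 := DFunLike.congr_fun (directSum_comp_inrL2 A₁ A₂) y
        exact (congrArg (· ∈ N) h2).mpr (hBN _ hy)) hbN
    refine h1 ?_
    rw [cyclicSubspace, show Submodule.topologicalClosure _ = ⊤ from hφ₂]; trivial
  have := N.add_mem (e1 v.fst) (e2 v.snd)
  rw [inlL2_add_inrL2] at this
  exact this

/-- Where the orthogonal part of `(φ₁, 0)` carries no mass the two spectral measures are mutually
singular. -/
theorem mutuallySingular_restrict_of_orthogonalPart (hA₁ : IsSelfAdjoint A₁)
    (hA₂ : IsSelfAdjoint A₂) (φ : WithLp 2 (K₁ × K₂)) {s : Set ℝ} (hs : MeasurableSet s)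
    (h : spectralMeasure (directSum A₁ A₂)
      (orthogonalPart (directSum A₁ A₂) φ (inlL2 K₁ K₂ φ.fst)) s = 0) :
    (spectralMeasure A₁ φ.fst).restrict s ⟂ₘ (spectralMeasure A₂ φ.snd).restrict s := by
  set B := directSum A₁ A₂ with hBdef
  have hB : IsSelfAdjoint B := isSelfAdjoint_directSum hA₁ hA₂
  set a := inlL2 K₁ K₂ φ.fst with ha
  set q := (cyclicSubspace B φ).starProjection a with hq
  have key : ∀ (κ : Measure ℝ), κ ≤ (spectralMeasure A₁ φ.fst).restrict s →
      κ ≤ (spectralMeasure A₂ φ.snd).restrict s → ∀ δ : ℝ, 0 < δ →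
      κ Set.univ ≤ ENNReal.ofReal δ := by
    intro κ h1 h2 δ hδ
    have hqc : q ∈ closure (Submodule.span ℂ (Set.range fun n : ℕ => (B ^ n) φ) :
        Set (WithLp 2 (K₁ × K₂))) := (cyclicSubspace B φ).starProjection_apply_mem a
    -- The `δ / 4` absorbs two factors `2`: one from subadditivity of the measures, one from `1 ≤
    -- 2(|1 - p|² + |p|²)`.
    obtain ⟨v, hv, hqv⟩ := Metric.mem_closure_iff.1 hqc (Real.sqrt (δ / 4)) (by positivity)
    obtain ⟨p, rfl⟩ := exists_aeval_eq_of_mem_span hv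
    -- The orthogonal part is null on `s`, so there `a - p(B)φ` is controlled by the small vector `q
    -- - p(B)φ`.
    have hm := spectralMeasure_add_le B (orthogonalPart B φ a) (q - Polynomial.aeval B p φ) s
    rw [h, mul_zero, zero_add, orthogonalPart, ← hq, sub_add_sub_cancel] at hm
    have hsplit : a - Polynomial.aeval B p φ =
        inlL2 K₁ K₂ (Polynomial.aeval A₁ (1 - p) φ.fst) +
          inrL2 K₁ K₂ (Polynomial.aeval A₂ (-p) φ.snd) := by
      have e1 := DFunLike.congr_fun
        (aeval_intertwine (inlL2 K₁ K₂) (directSum_comp_inlL2 A₁ A₂) p) φ.fst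
      have e2 := DFunLike.congr_fun
        (aeval_intertwine (inrL2 K₁ K₂) (directSum_comp_inrL2 A₁ A₂) p) φ.snd
      simp only [ContinuousLinearMap.comp_apply] at e1 e2
      conv_lhs => rw [← inlL2_add_inrL2 φ]
      rw [map_add, ← e1, ← e2]
      simp [ha]
      abel
    rw [hsplit, spectralMeasure_directSum hA₁ hA₂, spectralMeasure_aeval hA₁,
      spectralMeasure_aeval hA₂, Measure.add_apply, withDensity_apply _ hs,
      withDensity_apply _ hs] at hm
    calc κ Set.univ = ∫⁻ _, 1 ∂κ := by simp
      _ ≤ ∫⁻ x, (2 * (ENNReal.ofReal (‖(1 - p).eval (x : ℂ)‖ ^ 2) +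
            ENNReal.ofReal (‖(-p).eval (x : ℂ)‖ ^ 2))) ∂κ := by
          refine lintegral_mono fun x => ?_
          rw [← ENNReal.ofReal_add (by positivity) (by positivity), ← ENNReal.ofReal_one,
            ← ENNReal.ofReal_ofNat 2, ← ENNReal.ofReal_mul (by positivity)]
          refine ENNReal.ofReal_le_ofReal ?_
          have ht : (1 : ℝ) ≤ ‖(1 - p).eval (x : ℂ)‖ + ‖(-p).eval (x : ℂ)‖ := by
            have := norm_sub_le ((1 - p).eval (x : ℂ)) ((-p).eval (x : ℂ))
            simpa using this
          nlinarith [sq_nonneg (‖(1 - p).eval (x : ℂ)‖ - ‖(-p).eval (x : ℂ)‖)]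
      _ = 2 * (∫⁻ x, ENNReal.ofReal (‖(1 - p).eval (x : ℂ)‖ ^ 2) ∂κ +
            ∫⁻ x, ENNReal.ofReal (‖(-p).eval (x : ℂ)‖ ^ 2) ∂κ) := by
          rw [lintegral_const_mul _ (by fun_prop), lintegral_add_left (by fun_prop)]
      _ ≤ 2 * (∫⁻ x in s, ENNReal.ofReal (‖(1 - p).eval (x : ℂ)‖ ^ 2)
              ∂(spectralMeasure A₁ φ.fst) +
            ∫⁻ x in s, ENNReal.ofReal (‖(-p).eval (x : ℂ)‖ ^ 2) ∂(spectralMeasure A₂ φ.snd)) := by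
          gcongr
      _ ≤ 2 * (2 * ENNReal.ofReal (δ / 4)) := by
          gcongr
          refine hm.trans ?_
          gcongr
          refine (spectralMeasure_le B _ s).trans (ENNReal.ofReal_le_ofReal ?_)
          rw [dist_eq_norm] at hqv
          rw [← Real.sq_sqrt (show 0 ≤ δ / 4 by positivity)]
          gcongr
      _ = ENNReal.ofReal δ := by
          rw [← ENNReal.ofReal_ofNat 2, ← ENNReal.ofReal_mul (by positivity),
            ← ENNReal.ofReal_mul (by positivity)]
          congr 1
          ring
  rw [Measure.mutuallySingular_iff_disjoint]
  intro κ h1 h2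
  have h0 : κ Set.univ ≤ 0 := by
    refine ENNReal.le_of_forall_pos_le_add fun δ hδ _ => ?_
    simpa using key κ h1 h2 δ (by exact_mod_cast hδ)
  rw [Measure.measure_univ_eq_zero.1 (nonpos_iff_eq_zero.1 h0)]
  exact Measure.zero_le _

end DirectSum

/-! ### Singular parts and absolute continuity. -/

section SingularPart

/-- The singular part of `μ` is carried by a Lebesgue null set `t`, on which `ν` agrees with its own
singular part. -/
theorem absolutelyContinuous_singPart {μ ν : Measure ℝ} [IsFiniteMeasure μ] [IsFiniteMeasure ν]
    (h : μ ≪ ν) : singPart μ ≪ singPart ν := by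
  have hμ : singPart μ ⟂ₘ volume := Measure.mutuallySingular_singularPart μ volume
  intro s hs
  set t := hμ.nullSetᶜ
  have ht : volume t = 0 := hμ.measure_compl_nullSet
  have hνst : ν (s ∩ t) = 0 := by
    rw [← Measure.singularPart_add_rnDeriv ν volume, Measure.add_apply]
    have hνs : (ν.singularPart volume) (s ∩ t) = 0 := measure_mono_null Set.inter_subset_left hs
    rw [hνs, zero_add]
    exact withDensity_absolutelyContinuous _ _ (measure_mono_null Set.inter_subset_right ht)
  have h1 : singPart μ (s ∩ t) = 0 :=
    Measure.absolutelyContinuous_of_le (Measure.singularPart_le μ volume) (h hνst)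
  refine measure_mono_null (t := s ∩ t ∪ hμ.nullSet) (fun x hx => ?_)
    (measure_union_null h1 hμ.measure_nullSet)
  by_cases hxt : x ∈ hμ.nullSet
  · exact Or.inr hxt
  · exact Or.inl ⟨hx, hxt⟩

theorem singPart_add (μ ν : Measure ℝ) [IsFiniteMeasure μ] [IsFiniteMeasure ν] :
    singPart (μ + ν) = singPart μ + singPart ν :=
  Measure.singularPart_add μ ν volume

theorem singPart_restrict (μ : Measure ℝ) [IsFiniteMeasure μ] {s : Set ℝ} (hs : MeasurableSet s) :
    singPart (μ.restrict s) = (singPart μ).restrict s :=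
  Measure.singularPart_restrict μ volume hs

/-- Two measures are mutually singular when no nonzero measure is dominated by both. -/
theorem mutuallySingular_of_forall_ac {μ ν : Measure ℝ}
    (h : ∀ κ : Measure ℝ, κ ≪ μ → κ ≪ ν → κ = 0) : μ ⟂ₘ ν := by
  rw [Measure.mutuallySingular_iff_disjoint]
  intro κ h1 h2
  rw [h κ (Measure.absolutelyContinuous_of_le h1) (Measure.absolutelyContinuous_of_le h2)]
  exact Measure.zero_le _

end SingularPart

/-! ### Comparison partitions. -/

section ComparisonPartition

/-- Lebesgue decomposition of `μ₁` with respect to `μ₂`: `Z` carries the singular part, and off `Z`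
the density is nonzero on `X` and zero on `Y`. -/
theorem exists_isComparisonPartition (μ₁ μ₂ : Measure ℝ) [IsFiniteMeasure μ₁]
    [IsFiniteMeasure μ₂] : ∃ X Y Z : Set ℝ, IsComparisonPartition μ₁ μ₂ X Y Z := by
  have hs : μ₁.singularPart μ₂ ⟂ₘ μ₂ := Measure.mutuallySingular_singularPart μ₁ μ₂
  set S := hs.nullSet with hS
  have hSm : MeasurableSet S := hs.measurableSet_nullSet
  set f := μ₁.rnDeriv μ₂ with hf
  have hfm : Measurable f := Measure.measurable_rnDeriv _ _
  set T : Set ℝ := {x | f x ≠ 0} with hT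
  have hTm : MeasurableSet T := (hfm (measurableSet_singleton 0)).compl
  have hres : ∀ A ⊆ S, MeasurableSet A → μ₁.restrict A = (μ₂.restrict A).withDensity f := by
    intro A hAS hA
    conv_lhs => rw [← Measure.singularPart_add_rnDeriv μ₁ μ₂]
    rw [Measure.restrict_add, restrict_withDensity hA, Measure.restrict_eq_zero.2
      (measure_mono_null hAS hs.measure_nullSet), zero_add]
  refine ⟨S ∩ T, S \ T, Sᶜ, hSm.inter hTm, hSm.diff hTm, hSm.compl, ?_, ?_, ?_, ?_, ?_, ?_, ?_,
    hs.measure_compl_nullSet⟩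
  · exact Set.disjoint_left.2 fun x hx hy => hy.2 hx.2
  · exact Set.disjoint_left.2 fun x hx hy => hy hx.1
  · exact Set.disjoint_left.2 fun x hx hy => hy hx.1
  · rw [Set.inter_union_sdiff, Set.union_compl_self]
  · rw [hres _ Set.inter_subset_left (hSm.inter hTm)]
    exact withDensity_absolutelyContinuous _ _
  · rw [hres _ Set.inter_subset_left (hSm.inter hTm)]
    refine withDensity_absolutelyContinuous' hfm.aemeasurable ?_
    filter_upwards [ae_restrict_mem (hSm.inter hTm)] with x hx using hx.2
  · rw [← Measure.restrict_apply_univ, hres _ Set.sdiff_subset (hSm.diff hTm), withDensity_apply _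
      MeasurableSet.univ, Measure.restrict_univ,
      setLIntegral_congr_fun (hSm.diff hTm) (g := fun _ => 0)]
    · simp
    · intro x hx
      exact not_not.1 hx.2

variable {μ₁ μ₂ ω : Measure ℝ} {X Y Z : Set ℝ}

/-- A measure below both `μ₁` and `μ₂` lives on the part where these are equivalent. -/
theorem IsComparisonPartition.ac_restrict (h : IsComparisonPartition μ₁ μ₂ X Y Z)
    (h₁ : ω ≤ μ₁) (h₂ : ω ≤ μ₂) : ω ≪ (μ₁ + μ₂).restrict X := by
  intro s hs
  rw [Measure.restrict_apply' h.measurableSet_X, Measure.add_apply, add_eq_zero] at hs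
  have hX : ω (s ∩ X) = 0 := Measure.absolutelyContinuous_of_le h₁ hs.1
  have hY : ω Y = 0 := Measure.absolutelyContinuous_of_le h₁ h.null_Y
  have hZ : ω Z = 0 := Measure.absolutelyContinuous_of_le h₂ h.null_Z
  refine measure_mono_null (t := s ∩ X ∪ Y ∪ Z) (fun x hx => ?_)
    (measure_union_null (measure_union_null hX hY) hZ)
  have hu : x ∈ X ∪ Y ∪ Z := h.union_eq ▸ Set.mem_univ x
  rcases hu with (hu | hu) | hu
  · exact Or.inl (Or.inl ⟨hx, hu⟩)
  · exact Or.inl (Or.inr hu)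
  · exact Or.inr hu

/-- A measure whose null sets separate `μ₁` and `μ₂` dominates the part where these are
equivalent. -/
theorem IsComparisonPartition.restrict_ac (h : IsComparisonPartition μ₁ μ₂ X Y Z)
    (hω : ∀ s, MeasurableSet s → ω s = 0 → μ₁.restrict s ⟂ₘ μ₂.restrict s) :
    (μ₁ + μ₂).restrict X ≪ ω := by
  refine Measure.AbsolutelyContinuous.mk fun s hs hs0 => ?_
  have hms := hω s hs hs0
  set N := hms.nullSet
  have hN : MeasurableSet N := hms.measurableSet_nullSet
  have h1 : μ₁ (N ∩ s ∩ X) = 0 := by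
    have := hms.measure_nullSet
    rw [Measure.restrict_apply hN] at this
    exact measure_mono_null Set.inter_subset_left this
  have h2 : μ₂ (Nᶜ ∩ s ∩ X) = 0 := by
    have := hms.measure_compl_nullSet
    rw [Measure.restrict_apply hN.compl] at this
    exact measure_mono_null Set.inter_subset_left this
  rw [← Measure.restrict_apply' h.measurableSet_X] at h1 h2
  have h3 := h.ac₂₁ h1
  have h4 := h.ac₁₂ h2
  rw [Measure.restrict_add, Measure.add_apply, add_eq_zero]
  -- Each half is null for one measure, hence on `X` for the other by equivalence.
  have hsub : s ⊆ N ∩ s ∪ Nᶜ ∩ s := fun x hx => by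
    by_cases hxN : x ∈ N
    · exact Or.inl ⟨hxN, hx⟩
    · exact Or.inr ⟨hxN, hx⟩
  exact ⟨measure_mono_null hsub (measure_union_null h1 h4),
    measure_mono_null hsub (measure_union_null h3 h2)⟩

theorem IsComparisonPartition.restrict_singPart_eq_zero_iff [IsFiniteMeasure μ₁]
    [IsFiniteMeasure μ₂] (h : IsComparisonPartition μ₁ μ₂ X Y Z) :
    (singPart (μ₁ + μ₂)).restrict X = 0 ↔ singPart μ₁ ⟂ₘ singPart μ₂ := by
  have hX := h.measurableSet_X
  have le₁ := Measure.absolutelyContinuous_of_le (Measure.singularPart_le μ₁ volume)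
  have le₂ := Measure.absolutelyContinuous_of_le (Measure.singularPart_le μ₂ volume)
  rw [singPart_add]
  constructor
  · intro h0
    have h1 : singPart μ₁ X + singPart μ₂ X = 0 := by
      simpa using congrArg (fun m : Measure ℝ => m Set.univ) h0
    rw [add_eq_zero] at h1
    refine Measure.MutuallySingular.mk (s := X ∪ Y) (t := Z)
      (measure_union_null h1.1 (le₁ h.null_Y)) (le₂ h.null_Z) h.union_eq.symm.subset
  · intro hs
    have h1 : (singPart μ₁).restrict X ≪ (singPart μ₂).restrict X := by
      rw [← singPart_restrict μ₁ hX, ← singPart_restrict μ₂ hX]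
      exact absolutelyContinuous_singPart h.ac₁₂
    have h2 : (singPart μ₂).restrict X ≪ (singPart μ₁).restrict X := by
      rw [← singPart_restrict μ₁ hX, ← singPart_restrict μ₂ hX]
      exact absolutelyContinuous_singPart h.ac₂₁
    have hs' : (singPart μ₁).restrict X ⟂ₘ (singPart μ₂).restrict X :=
      hs.mono Measure.restrict_le_self Measure.restrict_le_self
    rw [Measure.restrict_add,
      Measure.eq_zero_of_absolutelyContinuous_of_mutuallySingular h1 hs',
      Measure.eq_zero_of_absolutelyContinuous_of_mutuallySingular h2 hs'.symm, add_zero]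

end ComparisonPartition

/-! ### The overlap of the singular parts. -/

section Overlap

variable {K₁ K₂ : Type*}
    [NormedAddCommGroup K₁] [InnerProductSpace ℂ K₁] [CompleteSpace K₁]
    [NormedAddCommGroup K₂] [InnerProductSpace ℂ K₂] [CompleteSpace K₂]
    {A₁ : K₁ →L[ℂ] K₁} {A₂ : K₂ →L[ℂ] K₂}

theorem spectralMeasure_directSum_self (hA₁ : IsSelfAdjoint A₁) (hA₂ : IsSelfAdjoint A₂)
    (u : WithLp 2 (K₁ × K₂)) : spectralMeasure (directSum A₁ A₂) u =
      spectralMeasure A₁ u.fst + spectralMeasure A₂ u.snd := by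
  rw [← spectralMeasure_directSum hA₁ hA₂, inlL2_add_inrL2]

theorem spectralMeasure_directSum_ac (hA₁ : IsSelfAdjoint A₁) (hA₂ : IsSelfAdjoint A₂)
    {φ : WithLp 2 (K₁ × K₂)} (hφ₁ : IsCyclicVector A₁ φ.fst) (hφ₂ : IsCyclicVector A₂ φ.snd)
    (u : WithLp 2 (K₁ × K₂)) : spectralMeasure (directSum A₁ A₂) u ≪
      spectralMeasure A₁ φ.fst + spectralMeasure A₂ φ.snd := by
  rw [spectralMeasure_directSum_self hA₁ hA₂]
  exact (spectralMeasure_ac_of_isCyclicVector hA₁ hφ₁ _).add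
    (spectralMeasure_ac_of_isCyclicVector hA₂ hφ₂ _)

theorem singularPartsOverlapExactlyIn_rankOnePerturbation (hA₁ : IsSelfAdjoint A₁)
    (hA₂ : IsSelfAdjoint A₂) {φ : WithLp 2 (K₁ × K₂)} (hφ₁ : IsCyclicVector A₁ φ.fst)
    (hφ₂ : IsCyclicVector A₂ φ.snd) {r : ℝ} (hr : r ≠ 0) {X Y Z : Set ℝ}
    (h : IsComparisonPartition (spectralMeasure A₁ φ.fst) (spectralMeasure A₂ φ.snd) X Y Z) :
    SingularPartsOverlapExactlyIn (directSum A₁ A₂)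
      (rankOnePerturbation (directSum A₁ A₂) r φ)
      ((singPart (spectralMeasure A₁ φ.fst + spectralMeasure A₂ φ.snd)).restrict X) := by
  set B := directSum A₁ A₂ with hBdef
  have hB : IsSelfAdjoint B := isSelfAdjoint_directSum hA₁ hA₂
  have hX := h.measurableSet_X
  set w := orthogonalPart B φ (inlL2 K₁ K₂ φ.fst) with hw
  have hρ : spectralMeasure B φ = spectralMeasure A₁ φ.fst + spectralMeasure A₂ φ.snd :=
    spectralMeasure_directSum_self hA₁ hA₂ φ
  have hω₁ : spectralMeasure B w ≤ spectralMeasure A₁ φ.fst :=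
    (spectralMeasure_orthogonalPart_le hB _ _).trans_eq
      (spectralMeasure_directSum_inlL2 hA₁ hA₂ _)
  have hω₂ : spectralMeasure B w ≤ spectralMeasure A₂ φ.snd := by
    rw [← spectralMeasure_directSum_inrL2 hA₁ hA₂, ← spectralMeasure_neg, hw,
      ← orthogonalPart_sub, sub_eq_of_eq_add' (inlL2_add_inrL2 φ).symm]
    exact spectralMeasure_orthogonalPart_le hB _ _
  have hac := absolutelyContinuous_singPart (h.ac_restrict hω₁ hω₂)
  have hca := absolutelyContinuous_singPart (h.restrict_ac (ω := spectralMeasure B w)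
    fun s hs hs0 => mutuallySingular_restrict_of_orthogonalPart hA₁ hA₂ φ hs hs0)
  rw [singPart_restrict _ hX] at hac hca
  have hms := mutuallySingular_rankOnePerturbation hB hr φ
  rw [hρ] at hms
  intro ν
  constructor
  · rintro ⟨⟨u, hu⟩, ⟨v, hv⟩⟩
    have hν := hu.trans (absolutelyContinuous_singPart
      (spectralMeasure_directSum_ac hA₁ hA₂ hφ₁ hφ₂ u))
    have hν' := hv.trans (absolutelyContinuous_singPart
      (spectralMeasure_rankOnePerturbation_ac hA₁ hA₂ hφ₁ hφ₂ r v))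
    rw [singPart_add] at hν'
    intro s hs
    -- `N` is null for the singular part of `φ` under `B`; its complement is null for that under the
    -- perturbation. So off `N` only the measure of `w` can charge `ν`.
    set N := hms.nullSet
    refine measure_mono_null (t := N ∪ s ∩ Nᶜ) (fun x hx => ?_)
      (measure_union_null (hν hms.measure_nullSet) (hν' ?_))
    · by_cases hxN : x ∈ N
      · exact Or.inl hxN
      · exact Or.inr ⟨hx, hxN⟩
    · rw [Measure.add_apply, add_eq_zero]
      exact ⟨measure_mono_null Set.inter_subset_right hms.measure_compl_nullSet,
        measure_mono_null Set.inter_subset_left (hac hs)⟩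
  · intro hν
    refine ⟨⟨φ, ?_⟩, ⟨w, ?_⟩⟩
    · rw [hρ]
      exact hν.trans (Measure.absolutelyContinuous_of_le Measure.restrict_le_self)
    · rw [hw, spectralMeasure_rankOnePerturbation_orthogonalPart hB]
      exact hν.trans hca

/-- Testing the overlap on `κ` itself shows `κ` is dominated by two mutually singular measures. -/
theorem SingularPartsOverlapExactlyIn.mutuallySingularSingularParts_iff {H H' : Type*}
    [NormedAddCommGroup H] [InnerProductSpace ℂ H] [CompleteSpace H] [NormedAddCommGroup H']
    [InnerProductSpace ℂ H'] [CompleteSpace H'] {S : H →L[ℂ] H} {T : H' →L[ℂ] H'}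
    {κ : Measure ℝ} (h : SingularPartsOverlapExactlyIn S T κ) :
    MutuallySingularSingularParts S T ↔ κ = 0 := by
  constructor
  · intro hST
    obtain ⟨⟨u, hu⟩, ⟨v, hv⟩⟩ := (h κ).2 Measure.AbsolutelyContinuous.rfl
    exact Measure.eq_zero_of_absolutelyContinuous_of_mutuallySingular
      Measure.AbsolutelyContinuous.rfl ((hST u v).mono_ac hu hv)
  · rintro rfl u v
    exact mutuallySingular_of_forall_ac fun κ h1 h2 =>
      Measure.absolutelyContinuous_zero_iff.1 ((h κ).1 ⟨⟨u, h1⟩, ⟨v, h2⟩⟩)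

theorem mutuallySingularSingularParts_iff_of_isCyclicVector (hA₁ : IsSelfAdjoint A₁)
    (hA₂ : IsSelfAdjoint A₂) {x : K₁} {y : K₂} (hx : IsCyclicVector A₁ x)
    (hy : IsCyclicVector A₂ y) : MutuallySingularSingularParts A₁ A₂ ↔
      singPart (spectralMeasure A₁ x) ⟂ₘ singPart (spectralMeasure A₂ y) :=
  ⟨fun h => h x y, fun h u v => h.mono_ac
    (absolutelyContinuous_singPart (spectralMeasure_ac_of_isCyclicVector hA₁ hx u))
    (absolutelyContinuous_singPart (spectralMeasure_ac_of_isCyclicVector hA₂ hy v))⟩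

end Overlap

end KacGilbert

theorem corollary2p1 {K₁ K₂ : Type*}
    [NormedAddCommGroup K₁] [InnerProductSpace ℂ K₁] [CompleteSpace K₁]
    [NormedAddCommGroup K₂] [InnerProductSpace ℂ K₂] [CompleteSpace K₂]
    (A₁ : K₁ →L[ℂ] K₁) (A₂ : K₂ →L[ℂ] K₂)
    (hA₁ : IsSelfAdjoint A₁) (hA₂ : IsSelfAdjoint A₂)
    (φ : WithLp 2 (K₁ × K₂))
    (hφ₁ : KacGilbert.IsCyclicVector A₁ φ.fst) (hφ₂ : KacGilbert.IsCyclicVector A₂ φ.snd)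
    (r : ℝ) (hr : r ≠ 0)
    (B C : WithLp 2 (K₁ × K₂) →L[ℂ] WithLp 2 (K₁ × K₂))
    (hB : B = KacGilbert.directSum A₁ A₂)
    (hC : C = KacGilbert.rankOnePerturbation B r φ)
    (μ₁ μ₂ : Measure ℝ)
    (hμ₁ : μ₁ = KacGilbert.spectralMeasure A₁ φ.fst)
    (hμ₂ : μ₂ = KacGilbert.spectralMeasure A₂ φ.snd) :
    (KacGilbert.MutuallySingularSingularParts B C ↔
      KacGilbert.MutuallySingularSingularParts A₁ A₂) ∧
    (∃ X Y Z : Set ℝ, KacGilbert.IsComparisonPartition μ₁ μ₂ X Y Z) ∧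
    (∀ X Y Z : Set ℝ, KacGilbert.IsComparisonPartition μ₁ μ₂ X Y Z →
      KacGilbert.SingularPartsOverlapExactlyIn B C
        ((KacGilbert.singPart (μ₁ + μ₂)).restrict X)) := by
  subst hB hC hμ₁ hμ₂
  refine ⟨?_, KacGilbert.exists_isComparisonPartition _ _, fun X Y Z h =>
    KacGilbert.singularPartsOverlapExactlyIn_rankOnePerturbation hA₁ hA₂ hφ₁ hφ₂ hr h⟩
  -- Any one partition suffices: both sides say that the singular part of `μ₁ + μ₂` vanishes on `X`.
  obtain ⟨X, Y, Z, h⟩ := KacGilbert.exists_isComparisonPartition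
    (KacGilbert.spectralMeasure A₁ φ.fst) (KacGilbert.spectralMeasure A₂ φ.snd)
  rw [(KacGilbert.singularPartsOverlapExactlyIn_rankOnePerturbation hA₁ hA₂ hφ₁ hφ₂ hr
      h).mutuallySingularSingularParts_iff, h.restrict_singPart_eq_zero_iff,
    KacGilbert.mutuallySingularSingularParts_iff_of_isCyclicVector hA₁ hA₂ hφ₁ hφ₂]
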